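/- Let $S^2\subset\mathbb{R}^3$ be the unit sphere with the round metric, area measure $dA$ (total area $4\pi$), gradient $\nabla$ and Laplace–Beltrami operator $\Delta$. Let $H^2(S^2)$ be the completion of the space $C^2(S^2)$ of real-valued $C^2$ functions with respect to the norm $$\|f\|_{H^2}=\Big(\int_{S^2} f^2\,dA+\int_{S^2}|\nabla f|^2\,dA+\int_{S^2}(\Delta f)^2\,dA\Big)^{1/2}.$$ Since the $H^2$ norm dominates the $L^2$ norm, each $u\in H^2(S^2)$ defines a class in $L^2(S^2)$. Then the series $$S=\sum_{l=0}^\infty \frac{(2l+1)^2}{1+l(l+1)+l^2(l+1)^2}$$ converges, and every $u\in H^2(S^2)$ agrees almost everywhere with a continuous function on $S^2$, whose supremum norm $\|u\|_{C^0}$ satisfies $$\|u\|_{C^0}\le \frac{\|u\|_{H^2}}{\sqrt{4\pi}}\,S^{1/2}.$$ Moreover, if $u\neq 0$, then $$\frac{\|u\|_{H^2}}{\sqrt{4\pi}}\,S^{1/2}<\frac12\sqrt{\frac1\pi\Big(\frac{\pi^2}{3}+2\Big)}\;\|u\|_{H^2}.$$ -/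

import Mathlib

open scoped Manifold ContDiff
open MeasureTheory

noncomputable section

/-- Euclidean three-space. -/
abbrev E3 : Type := EuclideanSpace ℝ (Fin 3)

/-- The round unit sphere in Euclidean three-space, with Mathlib's smooth structure. -/
abbrev S2 : Type := Metric.sphere (0 : E3) 1

/-- The area measure of the round unit sphere: the surface measure induced by Lebesgue measure,
of total mass `4 * π`. -/
def sphereArea : Measure S2 := (volume : Measure E3).toSphere

instance : IsFiniteMeasure sphereArea := by unfold sphereArea; infer_instance

instance : sphereArea.IsOpenPosMeasure := by unfold sphereArea; infer_instance

/-- The total area of the round unit sphere. -/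
theorem sphereArea_univ : sphereArea.real Set.univ = 4 * Real.pi := by
  unfold sphereArea
  rw [Measure.toSphere_real_apply_univ, Measure.real, InnerProductSpace.volume_ball_of_dim_odd
    (k := 1) (by simp)]
  have h : (0 : ℝ) ≤ Real.pi * 4 / 3 := by positivity
  simp only [Nat.doubleFactorial, finrank_euclideanSpace_fin]
  norm_num
  rw [ENNReal.toReal_ofReal h]
  ring

theorem radial_mem (x : E3) (hx : x ≠ 0) : ‖x‖⁻¹ • x ∈ Metric.sphere (0 : E3) 1 := by
  simp [norm_smul, hx]

open Classical in
/-- The extension of a function on the sphere to Euclidean space that is constant along rays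
(positively homogeneous of degree zero), with value `0` at the origin. -/
def radialExt (f : S2 → ℝ) (x : E3) : ℝ :=
  if hx : x = 0 then 0 else f ⟨‖x‖⁻¹ • x, radial_mem x hx⟩

theorem radialExt_coe (f : S2 → ℝ) (p : S2) : radialExt f p = f p := by
  have h : ‖(p : E3)‖ = 1 := norm_eq_of_mem_sphere p
  have h0 : (p : E3) ≠ 0 := ne_zero_of_mem_unit_sphere p
  simp [radialExt, h0, h]

/-- The gradient of `f` on the round sphere, as a vector of the ambient space tangent to the sphere
at `p`. As the radial extension of `f` is constant along rays, its Euclidean gradient at `p` has no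
normal component; its tangential part is the gradient for the induced metric. -/
def sphereGrad (f : S2 → ℝ) (p : S2) : E3 := gradient (radialExt f) (p : E3)

/-- The Laplace-Beltrami operator of the round sphere (the sign convention is that its eigenvalues
are `-l (l + 1)`): the Euclidean Laplacian of the extension that is constant along rays. -/
def sphereLap (f : S2 → ℝ) (p : S2) : ℝ := Laplacian.laplacian (radialExt f) (p : E3)

theorem radialExt_add (f g : S2 → ℝ) : radialExt (f + g) = radialExt f + radialExt g := by
  ext x
  by_cases hx : x = 0 <;> simp [radialExt, hx]

theorem radialExt_smul (c : ℝ) (f : S2 → ℝ) : radialExt (c • f) = c • radialExt f := by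
  ext x
  by_cases hx : x = 0 <;> simp [radialExt, hx]

theorem contDiffAt_radialExt {f : S2 → ℝ} (hf : ContMDiff (𝓡 2) 𝓘(ℝ, ℝ) 2 f) {x : E3}
    (hx : x ≠ 0) : ContDiffAt ℝ 2 (radialExt f) x := by
  have : Fact (Module.finrank ℝ E3 = 2 + 1) := ⟨by simp⟩
  let U : TopologicalSpace.Opens E3 := ⟨{0}ᶜ, isOpen_compl_singleton⟩
  have h1 : ContMDiff 𝓘(ℝ, E3) 𝓘(ℝ, E3) 2 (fun y : U => ‖(y : E3)‖⁻¹ • (y : E3)) := by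
    intro y
    have hy : (y : E3) ≠ 0 := y.2
    have h := (((contDiffAt_norm ℝ hy).inv (norm_ne_zero_iff.2 hy)).smul
      (contDiffAt_id (𝕜 := ℝ) (n := 2))).contMDiffAt
    exact contMDiffAt_subtype_iff.2 h
  have h2 := h1.codRestrict_sphere (n := 2) (fun y => radial_mem y y.2)
  have h3 := hf.comp h2
  have h4 : ContMDiffAt 𝓘(ℝ, E3) 𝓘(ℝ, ℝ) 2 (fun y : U => radialExt f y) ⟨x, hx⟩ := by
    refine (h3 ⟨x, hx⟩).congr_of_eventuallyEq (Filter.Eventually.of_forall fun y => ?_)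
    have hy : (y : E3) ≠ 0 := y.2
    simp only [radialExt, hy, dite_false, Function.comp]
    rfl
  exact (contMDiffAt_subtype_iff.1 h4).contDiffAt

theorem continuous_sphereGrad {f : S2 → ℝ} (hf : ContMDiff (𝓡 2) 𝓘(ℝ, ℝ) 2 f) :
    Continuous (sphereGrad f) := by
  rw [continuous_iff_continuousAt]
  intro p
  have h := contDiffAt_radialExt hf (ne_zero_of_mem_unit_sphere p)
  have h1 : ContinuousAt (fderiv ℝ (radialExt f)) (p : E3) :=
    (h.fderiv_right (m := 1) (by norm_num)).continuousAt
  have h2 : ContinuousAt (gradient (radialExt f)) (p : E3) :=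
    (InnerProductSpace.toDual ℝ E3).symm.continuous.continuousAt.comp h1
  exact ContinuousAt.comp (f := fun q : S2 => (q : E3)) h2 continuous_subtype_val.continuousAt

theorem continuous_sphereLap {f : S2 → ℝ} (hf : ContMDiff (𝓡 2) 𝓘(ℝ, ℝ) 2 f) :
    Continuous (sphereLap f) := by
  rw [continuous_iff_continuousAt]
  intro p
  have h := contDiffAt_radialExt hf (ne_zero_of_mem_unit_sphere p)
  have h1 : ContinuousAt (iteratedFDeriv ℝ 2 (radialExt f)) (p : E3) :=
    (h.iteratedFDeriv_right (m := 0) (i := 2) (by norm_num)).continuousAt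
  have h2 : ContinuousAt (Laplacian.laplacian (radialExt f)) (p : E3) := by
    rw [InnerProductSpace.laplacian_eq_iteratedFDeriv_stdOrthonormalBasis]
    refine tendsto_finsetSum _ fun i _ => ?_
    exact ((ContinuousMultilinearMap.apply ℝ (fun _ : Fin 2 => E3) ℝ _).continuous.continuousAt).comp
      h1
  exact ContinuousAt.comp (f := fun q : S2 => (q : E3)) h2 continuous_subtype_val.continuousAt

theorem sphereGrad_add {f g : S2 → ℝ} (hf : ContMDiff (𝓡 2) 𝓘(ℝ, ℝ) 2 f)
    (hg : ContMDiff (𝓡 2) 𝓘(ℝ, ℝ) 2 g) : sphereGrad (f + g) = sphereGrad f + sphereGrad g := by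
  ext1 p
  have h1 := (contDiffAt_radialExt hf (ne_zero_of_mem_unit_sphere p)).differentiableAt (by norm_num)
  have h2 := (contDiffAt_radialExt hg (ne_zero_of_mem_unit_sphere p)).differentiableAt (by norm_num)
  simp only [sphereGrad, radialExt_add, gradient, Pi.add_apply]
  rw [fderiv_add h1 h2, map_add]

theorem sphereGrad_smul (c : ℝ) (f : S2 → ℝ) : sphereGrad (c • f) = c • sphereGrad f := by
  ext1 p
  simp only [sphereGrad, radialExt_smul, gradient, Pi.smul_apply]
  rw [fderiv_const_smul_field]
  simp

theorem sphereLap_add {f g : S2 → ℝ} (hf : ContMDiff (𝓡 2) 𝓘(ℝ, ℝ) 2 f)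
    (hg : ContMDiff (𝓡 2) 𝓘(ℝ, ℝ) 2 g) : sphereLap (f + g) = sphereLap f + sphereLap g := by
  ext1 p
  simp only [sphereLap, radialExt_add, Pi.add_apply]
  exact (contDiffAt_radialExt hf (ne_zero_of_mem_unit_sphere p)).laplacian_add
    (contDiffAt_radialExt hg (ne_zero_of_mem_unit_sphere p))

theorem sphereLap_smul (c : ℝ) {f : S2 → ℝ} (hf : ContMDiff (𝓡 2) 𝓘(ℝ, ℝ) 2 f) :
    sphereLap (c • f) = c • sphereLap f := by
  ext1 p
  simp only [sphereLap, radialExt_smul, Pi.smul_apply]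
  exact InnerProductSpace.laplacian_smul c (contDiffAt_radialExt hf (ne_zero_of_mem_unit_sphere p))

/-- On the tangent space of the sphere, `sphereGrad f p` represents the differential of `f` with
respect to the metric induced by the Euclidean inner product. -/
theorem mfderiv_eq_inner_sphereGrad {f : S2 → ℝ} (hf : ContMDiff (𝓡 2) 𝓘(ℝ, ℝ) 2 f) (p : S2)
    (v : TangentSpace (𝓡 2) p) :
    (mfderiv (𝓡 2) 𝓘(ℝ, ℝ) f p v : ℝ) =
      inner ℝ (sphereGrad f p)
        (mfderiv (𝓡 2) 𝓘(ℝ, E3) (fun q : S2 => (q : E3)) p v : E3) := by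
  have : Fact (Module.finrank ℝ E3 = 2 + 1) := ⟨by simp⟩
  have hd : DifferentiableAt ℝ (radialExt f) (p : E3) :=
    (contDiffAt_radialExt hf (ne_zero_of_mem_unit_sphere p)).differentiableAt (by norm_num)
  have hc : MDifferentiableAt (𝓡 2) 𝓘(ℝ, E3) (fun q : S2 => (q : E3)) p :=
    (contMDiff_coe_sphere (m := 2) (n := 2) (E := E3)).mdifferentiableAt (by norm_num)
  have hcomp : f = radialExt f ∘ fun q : S2 => (q : E3) :=
    funext fun q => (radialExt_coe f q).symm
  have h := mfderiv_comp p hd.mdifferentiableAt hc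
  rw [← hcomp] at h
  rw [h, mfderiv_eq_fderiv]
  simp only [sphereGrad, gradient]
  exact (InnerProductSpace.toDual_symm_apply (𝕜 := ℝ)).symm

/-- The real-valued functions of class `C^2` on the round sphere, as a linear subspace. -/
def c2Submodule : Submodule ℝ (S2 → ℝ) where
  carrier := {f | ContMDiff (𝓡 2) 𝓘(ℝ, ℝ) 2 f}
  add_mem' hf hg := ContMDiff.add hf hg
  zero_mem' := contMDiff_const
  smul_mem' c f hf := by
    have hf' : ContMDiff (𝓡 2) 𝓘(ℝ, ℝ) 2 f := hf
    have hc : ContMDiff (𝓡 2) 𝓘(ℝ, ℝ) 2 (fun _ : S2 => c) := contMDiff_const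
    exact hc.smul hf'

/-- The space `C^2(S^2)`, to be normed by the `H^2` norm. -/
def C2Sphere : Type := c2Submodule

namespace C2Sphere

instance : AddCommGroup C2Sphere := inferInstanceAs (AddCommGroup c2Submodule)

instance : Module ℝ C2Sphere := inferInstanceAs (Module ℝ c2Submodule)

/-- The underlying function. -/
def toFun (f : C2Sphere) : S2 → ℝ := Subtype.val f

theorem contMDiff (f : C2Sphere) : ContMDiff (𝓡 2) 𝓘(ℝ, ℝ) 2 f.toFun :=
  (Subtype.property f : f.toFun ∈ c2Submodule)

theorem continuous_toFun (f : C2Sphere) : Continuous f.toFun := f.contMDiff.continuous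

theorem toFun_add (f g : C2Sphere) : (f + g).toFun = f.toFun + g.toFun := rfl

theorem toFun_smul (c : ℝ) (f : C2Sphere) : (c • f).toFun = c • f.toFun := rfl

/-- The inner product of `H^2`. -/
def h2Inner (f g : C2Sphere) : ℝ :=
  (∫ p, f.toFun p * g.toFun p ∂sphereArea)
    + (∫ p, inner ℝ (sphereGrad f.toFun p) (sphereGrad g.toFun p) ∂sphereArea)
    + ∫ p, sphereLap f.toFun p * sphereLap g.toFun p ∂sphereArea

theorem integrable_of_continuous {h : S2 → ℝ} (hh : Continuous h) : Integrable h sphereArea :=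
  hh.integrable_of_hasCompactSupport (HasCompactSupport.of_compactSpace h)

/-- `h2Inner` is a positive definite inner product. -/
@[reducible]
def h2Core : InnerProductSpace.Core ℝ C2Sphere where
  inner := h2Inner
  conj_inner_symm f g := by
    simp only [h2Inner, conj_trivial, mul_comm, real_inner_comm]
  re_inner_nonneg f := by
    simp only [h2Inner, RCLike.re_to_real]
    have h1 : 0 ≤ ∫ p, f.toFun p * f.toFun p ∂sphereArea :=
      integral_nonneg fun p => mul_self_nonneg _
    have h2 : 0 ≤ ∫ p, inner ℝ (sphereGrad f.toFun p) (sphereGrad f.toFun p) ∂sphereArea :=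
      integral_nonneg fun p => real_inner_self_nonneg
    have h3 : 0 ≤ ∫ p, sphereLap f.toFun p * sphereLap f.toFun p ∂sphereArea :=
      integral_nonneg fun p => mul_self_nonneg _
    linarith
  add_left f g k := by
    simp only [h2Inner, toFun_add, sphereGrad_add f.contMDiff g.contMDiff,
      sphereLap_add f.contMDiff g.contMDiff, Pi.add_apply, add_mul, inner_add_left]
    rw [integral_add (integrable_of_continuous (h := fun p => f.toFun p * k.toFun p)
          (f.continuous_toFun.mul k.continuous_toFun))
        (integrable_of_continuous (h := fun p => g.toFun p * k.toFun p)
          (g.continuous_toFun.mul k.continuous_toFun)),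
      integral_add
        (integrable_of_continuous
          ((continuous_sphereGrad f.contMDiff).inner (continuous_sphereGrad k.contMDiff)))
        (integrable_of_continuous
          ((continuous_sphereGrad g.contMDiff).inner (continuous_sphereGrad k.contMDiff))),
      integral_add
        (integrable_of_continuous (h := fun p => sphereLap f.toFun p * sphereLap k.toFun p)
          ((continuous_sphereLap f.contMDiff).mul (continuous_sphereLap k.contMDiff)))
        (integrable_of_continuous (h := fun p => sphereLap g.toFun p * sphereLap k.toFun p)
          ((continuous_sphereLap g.contMDiff).mul (continuous_sphereLap k.contMDiff)))]
    ring
  smul_left f g c := by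
    simp only [h2Inner, toFun_smul, sphereGrad_smul, sphereLap_smul c f.contMDiff, Pi.smul_apply,
      smul_eq_mul, mul_assoc, real_inner_smul_left, integral_const_mul, conj_trivial]
    ring
  definite f hf := by
    have h1 : 0 ≤ ∫ p, f.toFun p * f.toFun p ∂sphereArea :=
      integral_nonneg fun p => mul_self_nonneg _
    have h2 : 0 ≤ ∫ p, inner ℝ (sphereGrad f.toFun p) (sphereGrad f.toFun p) ∂sphereArea :=
      integral_nonneg fun p => real_inner_self_nonneg
    have h3 : 0 ≤ ∫ p, sphereLap f.toFun p * sphereLap f.toFun p ∂sphereArea :=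
      integral_nonneg fun p => mul_self_nonneg _
    have h4 : ∫ p, f.toFun p * f.toFun p ∂sphereArea = 0 := by
      have h5 : h2Inner f f = 0 := hf
      simp only [h2Inner] at h5
      linarith
    have hc : Continuous fun p => f.toFun p * f.toFun p :=
      f.continuous_toFun.mul f.continuous_toFun
    have h6 := (integral_eq_zero_iff_of_nonneg (fun p => mul_self_nonneg (f.toFun p))
      (integrable_of_continuous hc)).1 h4
    have h7 := Measure.eq_of_ae_eq h6 hc continuous_zero
    refine Subtype.ext (funext fun p => ?_)
    exact mul_self_eq_zero.1 (congrFun h7 p)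

instance : NormedAddCommGroup C2Sphere := h2Core.toNormedAddCommGroup

instance : InnerProductSpace ℝ C2Sphere := InnerProductSpace.ofCore h2Core.toCore

/-- The norm of `C2Sphere` is the `H^2` norm. -/
theorem norm_eq (f : C2Sphere) :
    ‖f‖ = Real.sqrt ((∫ p, f.toFun p ^ 2 ∂sphereArea)
      + (∫ p, ‖sphereGrad f.toFun p‖ ^ 2 ∂sphereArea)
      + ∫ p, sphereLap f.toFun p ^ 2 ∂sphereArea) := by
  have h : ‖f‖ = Real.sqrt (h2Inner f f) := rfl
  rw [h]
  simp only [h2Inner, real_inner_self_eq_norm_sq, pow_two]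

/-- The underlying function as a continuous map. -/
def toContinuousMap (f : C2Sphere) : C(S2, ℝ) := ⟨f.toFun, f.continuous_toFun⟩

theorem norm_toLp_le (f : C2Sphere) :
    ‖ContinuousMap.toLp 2 sphereArea ℝ f.toContinuousMap‖ ≤ ‖f‖ := by
  have h1 : ‖ContinuousMap.toLp 2 sphereArea ℝ f.toContinuousMap‖ ^ 2
      = ∫ p, f.toFun p ^ 2 ∂sphereArea := by
    rw [← real_inner_self_eq_norm_sq, ContinuousMap.inner_toLp]
    simp [toContinuousMap, pow_two]
  have h2 : 0 ≤ ∫ p, ‖sphereGrad f.toFun p‖ ^ 2 ∂sphereArea := integral_nonneg fun p => sq_nonneg _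
  have h3 : 0 ≤ ∫ p, sphereLap f.toFun p ^ 2 ∂sphereArea := integral_nonneg fun p => sq_nonneg _
  rw [norm_eq]
  apply Real.le_sqrt_of_sq_le
  linarith

/-- The inclusion of `C^2(S^2)`, with the `H^2` norm, into `L^2(S^2)`. -/
def toL2 : C2Sphere →L[ℝ] Lp ℝ 2 sphereArea :=
  LinearMap.mkContinuous
    { toFun := fun f => ContinuousMap.toLp 2 sphereArea ℝ f.toContinuousMap
      map_add' := fun f g => by rw [← map_add]; rfl
      map_smul' := fun c f => by rw [RingHom.id_apply, ← map_smul]; rfl }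
    1 (fun f => by simpa using f.norm_toLp_le)

end C2Sphere

/-- The Sobolev space `H^2(S^2)`: the completion of `C^2(S^2)` with respect to the `H^2` norm. -/
abbrev H2Sphere : Type := UniformSpace.Completion C2Sphere

/-- The function (class modulo null sets) that an element of `H^2(S^2)` stands for: the continuous
extension to the completion of the inclusion of `C^2(S^2)` into `L^2(S^2)`. -/
def H2Sphere.toL2 : H2Sphere →L[ℝ] Lp ℝ 2 sphereArea :=
  C2Sphere.toL2.extend UniformSpace.Completion.toComplL

/-- On `C^2` functions `H2Sphere.toL2` is the inclusion. -/
theorem H2Sphere.toL2_coe (f : C2Sphere) : H2Sphere.toL2 (f : H2Sphere) = C2Sphere.toL2 f :=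
  ContinuousLinearMap.extend_eq _ UniformSpace.Completion.denseRange_coe
    (UniformSpace.Completion.isUniformInducing_coe _) f

end

/-! No expansion in spherical harmonics is needed: the embedding holds with the constant √2 / √(4π),
and the series satisfies 2 ≤ S ≤ 5. The constant comes from the Green function of the sphere. With t
the inner product of p and q, G = log((1 - t)/2) + 1 satisfies ΔG = 4π δ_p - 1, so 4π f(p) = ∫ f + ∫
G Δf. Since ∫ 1 = ∫ G² = 4π, Cauchy–Schwarz gives (4π f(p))² ≤ 8π (∫ f² + ∫ (Δf)²), which is
`C2Sphere.toFun_sq_le`; the gradient term is simply discarded. To avoid the singularity, 1 - t is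
replaced by 1 + ε - t. Then ΔG + 1 becomes an explicit approximate identity `peakKernel`
(`legendre_logKernel`, `tendsto_integral_peakKernel_mul`), and ε tends to 0 at the end. Two facts
about the sphere carry this. Green's second identity (`integral_mul_sphereLap_sub`) is deduced from
Euclidean integration by parts in a spherical shell. Archimedes' theorem (`integral_zonal`) reduces
∫ G² to an integral over [-1, 1]. Density of C² functions extends the bound to the completion. For
the series, the first two terms already exceed 2 and a telescoping majorant gives 5, which is less
than π²/3 + 2 because π > 3. -/

noncomputable section

/-! ### Euclidean calculus of functions constant along rays -/

/-- The integral of a directional derivative of a compactly supported `C^1` function vanishes. -/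
theorem integral_fderiv_apply_eq_zero {W : E3 → ℝ} (hW : ContDiff ℝ 1 W)
    (hc : HasCompactSupport W) (v : E3) : ∫ x, fderiv ℝ W x v = 0 := by
  have hi : Integrable (fun x => fderiv ℝ W x v) := by
    refine ((hW.continuous_fderiv (by norm_num)).clm_apply
      continuous_const).integrable_of_hasCompactSupport ?_
    exact hc.fderiv_apply (𝕜 := ℝ) v
  have h := integral_mul_fderiv_eq_neg_fderiv_mul_of_integrable (μ := (volume : Measure E3))
    (f := fun _ : E3 => (1 : ℝ)) (g := W) (v := v) (by simp) (by simpa using hi)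
    (by simpa using hW.continuous.integrable_of_hasCompactSupport hc)
    (fun x _ => differentiableAt_const _) (fun x _ => hW.differentiable (by norm_num) x)
  simpa using h

theorem laplacian_eq_sum_fderiv {F : E3 → ℝ} {x : E3} (hF : ContDiffAt ℝ 2 F x) :
    Laplacian.laplacian F x = ∑ i : Fin 3, fderiv ℝ
      (fun y => fderiv ℝ F y (EuclideanSpace.single i 1)) x (EuclideanSpace.single i 1) := by
  rw [InnerProductSpace.laplacian_eq_iteratedFDeriv_orthonormalBasis F
    (EuclideanSpace.basisFun (Fin 3) ℝ)]
  refine Finset.sum_congr rfl fun i _ => ?_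
  rw [iteratedFDeriv_two_apply]
  have hd : DifferentiableAt ℝ (fderiv ℝ F) x :=
    (hF.fderiv_right (m := 1) (by norm_num)).differentiableAt (by norm_num)
  rw [fderiv_clm_apply hd (differentiableAt_const _)]
  simp

theorem radialExt_smul_arg (f : S2 → ℝ) {c : ℝ} (hc : 0 < c) (x : E3) :
    radialExt f (c • x) = radialExt f x := by
  by_cases hx : x = 0
  · simp [hx]
  · have h1 : c • x ≠ 0 := smul_ne_zero hc.ne' hx
    simp only [radialExt, h1, hx, dite_false]
    congr 2
    rw [norm_smul, Real.norm_of_nonneg hc.le, smul_smul]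
    congr 1
    field_simp

/-- Euler's relation in degree zero. In Green's identity it annihilates the terms containing the
derivative of the radial cutoff. -/
theorem fderiv_radialExt_self {f : S2 → ℝ} {x : E3}
    (hf : DifferentiableAt ℝ (radialExt f) x) : fderiv ℝ (radialExt f) x x = 0 := by
  have h1 : HasDerivAt (fun t : ℝ => t • x) x 1 := by
    simpa using (hasDerivAt_id (1 : ℝ)).smul_const x
  have hf' : HasFDerivAt (radialExt f) (fderiv ℝ (radialExt f) x) ((1 : ℝ) • x) := by
    simpa using hf.hasFDerivAt
  have h2 := hf'.comp_hasDerivAt (1 : ℝ) h1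
  have h3 : HasDerivAt (radialExt f ∘ fun t : ℝ => t • x) 0 1 := by
    refine (hasDerivAt_const (1 : ℝ) (radialExt f x)).congr_of_eventuallyEq ?_
    filter_upwards [lt_mem_nhds (zero_lt_one (α := ℝ))] with t ht
    exact radialExt_smul_arg f ht x
  exact h2.unique h3

/-- Invariance under the dilation by c passes to second derivatives, each of the two slots
contributing a factor c. A dilation is a linear equivalence, so no smoothness of f is required. -/
theorem laplacian_radialExt_smul (f : S2 → ℝ) {c : ℝ} (hc : 0 < c) (x : E3) :
    Laplacian.laplacian (radialExt f) x
      = c ^ 2 * Laplacian.laplacian (radialExt f) (c • x) := by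
  let g : E3 ≃L[ℝ] E3 := ContinuousLinearEquiv.smulLeft (Units.mk0 c hc.ne')
  have hg : ∀ y, g y = c • y := fun y => rfl
  have hcomp : radialExt f ∘ g = radialExt f := by
    ext y; simp only [Function.comp, hg]; exact radialExt_smul_arg f hc y
  have h := g.iteratedFDerivWithin_comp_right (radialExt f) uniqueDiffOn_univ
    (Set.mem_univ (g x)) 2
  rw [hcomp, Set.preimage_univ, iteratedFDerivWithin_univ] at h
  rw [InnerProductSpace.laplacian_eq_iteratedFDeriv_stdOrthonormalBasis]
  simp only [h, Finset.mul_sum]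
  refine Finset.sum_congr rfl fun i _ => ?_
  rw [ContinuousMultilinearMap.compContinuousLinearMap_apply, hg]
  have := (iteratedFDeriv ℝ 2 (radialExt f) (c • x)).map_smul_univ (fun _ => c)
    ![stdOrthonormalBasis ℝ E3 i, stdOrthonormalBasis ℝ E3 i]
  simp only [Finset.prod_const, Finset.card_univ, Fintype.card_fin, smul_eq_mul] at this
  rw [← this]
  congr 1

theorem laplacian_radialExt (f : S2 → ℝ) {x : E3} (hx : x ≠ 0) :
    Laplacian.laplacian (radialExt f) x = (‖x‖ ^ 2)⁻¹ * radialExt (sphereLap f) x := by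
  rw [laplacian_radialExt_smul f (inv_pos.2 (norm_pos_iff.2 hx)) x]
  simp [radialExt, hx, sphereLap]

/-! ### Polar coordinates and Green's second identity -/

/-- Integration in polar coordinates of the product of a radial function and a function constant
along rays. -/
theorem integral_radial_mul_radialExt (a : ℝ → ℝ) (h : S2 → ℝ) :
    ∫ x : E3, a ‖x‖ * radialExt h x
      = (∫ r : Set.Ioi (0 : ℝ), a r ∂Measure.volumeIoiPow 2) * ∫ q, h q ∂sphereArea :=
  calc
    ∫ x : E3, a ‖x‖ * radialExt h x
      = ∫ x : ({(0)}ᶜ : Set E3), a ‖x.1‖ * radialExt h x.1 ∂((volume : Measure E3).comap (↑)) := by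
      rw [integral_subtype_comap (measurableSet_singleton _).compl
        fun x => a ‖x‖ * radialExt h x, restrict_compl_singleton]
    _ = ∫ x, h x.1 * a x.2 ∂sphereArea.prod (.volumeIoiPow 2) := by
      have e := (volume : Measure E3).measurePreserving_homeomorphUnitSphereProd.integral_comp
        (Homeomorph.measurableEmbedding _) (fun x => h x.1 * a x.2)
      simp only [finrank_euclideanSpace_fin] at e
      rw [sphereArea, ← e]
      refine integral_congr_ae (Filter.Eventually.of_forall fun x => ?_)
      have hx : (x : E3) ≠ 0 := x.2
      simp only [radialExt, hx, dite_false]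
      rw [mul_comm, homeomorphUnitSphereProd_apply_snd_coe]
      congr 2
      exact Subtype.ext (homeomorphUnitSphereProd_apply_fst_coe E3 x).symm
    _ = _ := by rw [integral_prod_mul h (fun r : Set.Ioi (0 : ℝ) => a r), mul_comm]

/-- A bump function of the squared radius, supported in `[1, 3]`. -/
def shellBump : ContDiffBump (2 : ℝ) := ⟨1 / 2, 1, by norm_num, by norm_num⟩

/-- A smooth radial function supported in a spherical shell. -/
def shellWeight (x : E3) : ℝ := shellBump (‖x‖ ^ 2)

theorem contDiff_shellWeight : ContDiff ℝ 1 shellWeight :=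
  shellBump.contDiff.comp (contDiff_norm_sq ℝ)

theorem shellWeight_eq_zero {x : E3} (hx : ‖x‖ ^ 2 ≤ 1 ∨ 3 ≤ ‖x‖ ^ 2) : shellWeight x = 0 := by
  refine shellBump.zero_of_le_dist ?_
  change (1 : ℝ) ≤ _
  rw [Real.dist_eq, le_abs]
  rcases hx with h | h
  · right; linarith
  · left; linarith

theorem hasCompactSupport_shellWeight : HasCompactSupport shellWeight := by
  refine HasCompactSupport.intro (isCompact_closedBall (0 : E3) 2) fun x hx => ?_
  refine shellWeight_eq_zero (Or.inr ?_)
  rw [mem_closedBall_zero_iff, not_le] at hx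
  nlinarith

theorem shellWeight_eventually_zero : shellWeight =ᶠ[nhds 0] 0 := by
  filter_upwards [Metric.ball_mem_nhds (0 : E3) one_pos] with x hx
  refine shellWeight_eq_zero (Or.inl ?_)
  rw [mem_ball_zero_iff] at hx
  nlinarith [norm_nonneg x]

theorem fderiv_shellWeight (x v : E3) :
    fderiv ℝ shellWeight x v = 2 * deriv shellBump (‖x‖ ^ 2) * inner ℝ x v := by
  have h1 : HasDerivAt shellBump (deriv shellBump (‖x‖ ^ 2)) (‖x‖ ^ 2) :=
    ((shellBump.contDiff (n := 1)).differentiable (by norm_num) _).hasDerivAt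
  have h2 := h1.comp_hasFDerivAt x (hasStrictFDerivAt_norm_sq x).hasFDerivAt
  have h3 : fderiv ℝ shellWeight x = _ := h2.fderiv
  rw [h3]
  simp
  ring

/-- Ensures that the radial factor split off in polar coordinates can be cancelled. -/
theorem integral_shellWeight_pos : 0 < ∫ x : E3, shellWeight x * (‖x‖ ^ 2)⁻¹ := by
  have hc : Continuous fun x : E3 => shellWeight x * (‖x‖ ^ 2)⁻¹ := by
    rw [continuous_iff_continuousAt]
    intro x
    by_cases hx : x = 0
    · subst hx
      refine (continuousAt_const (y := (0 : ℝ))).congr ?_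
      filter_upwards [shellWeight_eventually_zero] with y hy
      simp [hy]
    · exact contDiff_shellWeight.continuous.continuousAt.mul
        ((continuous_norm.pow 2).continuousAt.inv₀ (by simpa using hx))
  have hs : HasCompactSupport fun x : E3 => shellWeight x * (‖x‖ ^ 2)⁻¹ :=
    hasCompactSupport_shellWeight.mul_right
  -- The witness has squared norm 2, the centre of the bump.
  refine hc.integral_pos_of_hasCompactSupport_nonneg_nonzero hs
    (fun x => mul_nonneg shellBump.nonneg (by positivity))
    (x := EuclideanSpace.single 0 (√2)) ?_
  have h : shellWeight (EuclideanSpace.single 0 (√2)) = 1 := by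
    refine shellBump.one_of_mem_closedBall ?_
    simp [abs_of_nonneg, shellBump]
  rw [h]
  simp

theorem sum_mul_fderiv_single (F : E3 → ℝ) (x : E3) :
    ∑ i : Fin 3, x i * fderiv ℝ F x (EuclideanSpace.single i 1) = fderiv ℝ F x x := by
  have h := congrArg (fderiv ℝ F x) ((EuclideanSpace.basisFun (Fin 3) ℝ).sum_repr x)
  simpa only [map_sum, map_smul, EuclideanSpace.basisFun_apply, EuclideanSpace.basisFun_repr,
    smul_eq_mul] using h

/-- The component along `v` of the vector field of Green's second identity, cut off to a shell. -/
def greenField (F G : E3 → ℝ) (v x : E3) : ℝ :=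
  shellWeight x * (G x * fderiv ℝ F x v - F x * fderiv ℝ G x v)

/-- The cutoff vanishes near the origin, the only point where F and G may fail to be smooth. -/
theorem contDiff_greenField {F G : E3 → ℝ} (hF : ∀ x ≠ 0, ContDiffAt ℝ 2 F x)
    (hG : ∀ x ≠ 0, ContDiffAt ℝ 2 G x) (v : E3) : ContDiff ℝ 1 (greenField F G v) := by
  rw [contDiff_iff_contDiffAt]
  intro x
  by_cases hx : x = 0
  · subst hx
    refine (contDiffAt_const (c := (0 : ℝ))).congr_of_eventuallyEq ?_
    filter_upwards [shellWeight_eventually_zero] with y hy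
    simp [greenField, hy]
  · have h1 : ContDiffAt ℝ 1 (fun y => fderiv ℝ F y v) x :=
      ((hF x hx).fderiv_right (m := 1) (by norm_num)).clm_apply contDiffAt_const
    have h2 : ContDiffAt ℝ 1 (fun y => fderiv ℝ G y v) x :=
      ((hG x hx).fderiv_right (m := 1) (by norm_num)).clm_apply contDiffAt_const
    exact contDiff_shellWeight.contDiffAt.mul
      ((((hG x hx).of_le (by norm_num)).mul h1).sub (((hF x hx).of_le (by norm_num)).mul h2))

theorem hasCompactSupport_greenField (F G : E3 → ℝ) (v : E3) :
    HasCompactSupport (greenField F G v) :=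
  hasCompactSupport_shellWeight.mul_right

theorem fderiv_greenField {F G : E3 → ℝ} {x : E3} (hF : ContDiffAt ℝ 2 F x)
    (hG : ContDiffAt ℝ 2 G x) (v : E3) :
    fderiv ℝ (greenField F G v) x v =
      2 * deriv shellBump (‖x‖ ^ 2) * (G x * (inner ℝ x v * fderiv ℝ F x v)
        - F x * (inner ℝ x v * fderiv ℝ G x v))
      + shellWeight x * (G x * fderiv ℝ (fun y => fderiv ℝ F y v) x v
        - F x * fderiv ℝ (fun y => fderiv ℝ G y v) x v) := by
  have hw := (contDiff_shellWeight.differentiable (by norm_num) x).hasFDerivAt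
  have h1 : DifferentiableAt ℝ (fun y => fderiv ℝ F y v) x :=
    (((hF.fderiv_right (m := 1) (by norm_num)).clm_apply
      contDiffAt_const).differentiableAt (by norm_num))
  have h2 : DifferentiableAt ℝ (fun y => fderiv ℝ G y v) x :=
    (((hG.fderiv_right (m := 1) (by norm_num)).clm_apply
      contDiffAt_const).differentiableAt (by norm_num))
  have hF1 := (hF.differentiableAt (by norm_num)).hasFDerivAt
  have hG1 := (hG.differentiableAt (by norm_num)).hasFDerivAt
  have h := (hw.mul ((hG1.mul h1.hasFDerivAt).sub (hF1.mul h2.hasFDerivAt))).fderiv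
  have h' : fderiv ℝ (greenField F G v) x = _ := h
  rw [h']
  simp only [add_apply, sub_apply, smul_apply, smul_eq_mul, fderiv_shellWeight, Pi.sub_apply,
    Pi.mul_apply]
  ring

/-- This is the divergence of w (G ∇F - F ∇G). The products ∇F · ∇G cancel, and ∇w is radial while F
and G have zero radial derivative. Only w (G ΔF - F ΔG) survives, and homogeneity turns ΔF and ΔG
into spherical Laplacians. -/
theorem sum_fderiv_greenField {f g : S2 → ℝ}
    (hf : ∀ x ≠ 0, ContDiffAt ℝ 2 (radialExt f) x)
    (hg : ∀ x ≠ 0, ContDiffAt ℝ 2 (radialExt g) x) (x : E3) :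
    ∑ i : Fin 3, fderiv ℝ (greenField (radialExt f) (radialExt g) (EuclideanSpace.single i 1)) x
      (EuclideanSpace.single i 1) =
      shellWeight x * (‖x‖ ^ 2)⁻¹ *
        radialExt (fun q => g q * sphereLap f q - f q * sphereLap g q) x := by
  by_cases hx : x = 0
  · subst hx
    rw [shellWeight_eq_zero (by simp)]
    simp only [zero_mul]
    refine Finset.sum_eq_zero fun i _ => ?_
    have : greenField (radialExt f) (radialExt g) (EuclideanSpace.single i 1) =ᶠ[nhds 0] 0 := by
      filter_upwards [shellWeight_eventually_zero] with y hy
      simp [greenField, hy]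
    rw [this.fderiv_eq]
    simp
  · simp only [fderiv_greenField (hf x hx) (hg x hx), Finset.sum_add_distrib, ← Finset.mul_sum,
      Finset.sum_sub_distrib, EuclideanSpace.inner_single_right, one_mul, conj_trivial,
      sum_mul_fderiv_single, ← laplacian_eq_sum_fderiv (hf x hx),
      ← laplacian_eq_sum_fderiv (hg x hx), laplacian_radialExt _ hx,
      fderiv_radialExt_self ((hf x hx).differentiableAt (by norm_num)),
      fderiv_radialExt_self ((hg x hx).differentiableAt (by norm_num))]
    simp only [radialExt, hx, dite_false]
    ring

/-- Green's second identity on the sphere. -/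
theorem integral_mul_sphereLap_sub {f g : S2 → ℝ}
    (hf : ∀ x ≠ 0, ContDiffAt ℝ 2 (radialExt f) x)
    (hg : ∀ x ≠ 0, ContDiffAt ℝ 2 (radialExt g) x) :
    ∫ q, (g q * sphereLap f q - f q * sphereLap g q) ∂sphereArea = 0 := by
  have h0 : ∫ x : E3, shellWeight x * (‖x‖ ^ 2)⁻¹ *
      radialExt (fun q => g q * sphereLap f q - f q * sphereLap g q) x = 0 := by
    simp only [← sum_fderiv_greenField hf hg]
    rw [integral_finsetSum]
    · exact Finset.sum_eq_zero fun i _ => integral_fderiv_apply_eq_zero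
        (contDiff_greenField hf hg _) (hasCompactSupport_greenField _ _ _) _
    · intro i _
      refine (((contDiff_greenField hf hg _).continuous_fderiv (by norm_num)).clm_apply
        continuous_const).integrable_of_hasCompactSupport ?_
      exact (hasCompactSupport_greenField _ _ _).fderiv_apply (𝕜 := ℝ) _
  have h1 := integral_radial_mul_radialExt (fun r => shellBump (r ^ 2) * (r ^ 2)⁻¹)
    (fun q => g q * sphereLap f q - f q * sphereLap g q)
  have h2 := integral_radial_mul_radialExt (fun r => shellBump (r ^ 2) * (r ^ 2)⁻¹) (fun _ => 1)
  have h3 : ∫ x : E3, shellWeight x * (‖x‖ ^ 2)⁻¹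
      = ∫ x : E3, shellBump (‖x‖ ^ 2) * (‖x‖ ^ 2)⁻¹ * radialExt (fun _ => 1) x := by
    refine integral_congr_ae (Filter.Eventually.of_forall fun x => ?_)
    by_cases hx : x = 0
    · simp [hx]
    · simp [radialExt, hx, shellWeight]
  -- The radial factor is nonzero: with the constant 1 as spherical function, the same factorization
  -- has a positive integral.
  have h4 : (∫ r : Set.Ioi (0 : ℝ), shellBump ((r : ℝ) ^ 2) * ((r : ℝ) ^ 2)⁻¹
      ∂Measure.volumeIoiPow 2) ≠ 0 := by
    intro h
    have := integral_shellWeight_pos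
    rw [h3, h2, h, zero_mul] at this
    exact lt_irrefl _ this
  exact (mul_eq_zero.1 (h1.symm.trans h0)).resolve_left h4

/-! ### Zonal functions and the Legendre operator -/

theorem inner_mem_Icc (p q : S2) : inner ℝ (p : E3) (q : E3) ∈ Set.Icc (-1 : ℝ) 1 := by
  have h := abs_real_inner_le_norm (p : E3) (q : E3)
  rw [norm_eq_of_mem_sphere p, norm_eq_of_mem_sphere q, one_mul] at h
  exact abs_le.1 h

/-- The function on the sphere whose value at `q` depends only on the height of `q` in the
direction of `p`. -/
def zonal (γ : ℝ → ℝ) (p q : S2) : ℝ := γ (inner ℝ (p : E3) (q : E3))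

theorem continuous_zonal {γ : ℝ → ℝ} (hγ : ContinuousOn γ (Set.Icc (-1) 1)) (p : S2) :
    Continuous (zonal γ p) :=
  hγ.comp_continuous (continuous_const.inner continuous_subtype_val) fun q => inner_mem_Icc p q

theorem inner_mul_norm_inv_mem_Icc (p : S2) {x : E3} (hx : x ≠ 0) :
    inner ℝ (p : E3) x * ‖x‖⁻¹ ∈ Set.Icc (-1 : ℝ) 1 := by
  have h := inner_mem_Icc p ⟨‖x‖⁻¹ • x, radial_mem x hx⟩
  rwa [inner_smul_right, mul_comm] at h

theorem radialExt_zonal (γ : ℝ → ℝ) (p : S2) {x : E3} (hx : x ≠ 0) :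
    radialExt (zonal γ p) x = γ (inner ℝ (p : E3) x * ‖x‖⁻¹) := by
  simp only [radialExt, hx, dite_false, zonal, inner_smul_right, mul_comm]

theorem hasFDerivAt_norm_inv {x : E3} (hx : x ≠ 0) :
    HasFDerivAt (fun y : E3 => ‖y‖⁻¹) (-(‖x‖⁻¹ ^ 3) • innerSL ℝ x) x := by
  have hn : ‖x‖ ≠ 0 := norm_ne_zero_iff.2 hx
  have h1 := (hasStrictFDerivAt_norm_sq x).hasFDerivAt.sqrt (pow_ne_zero 2 hn)
  simp only [Real.sqrt_sq (norm_nonneg _)] at h1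
  have h2 := (hasDerivAt_inv hn).comp_hasFDerivAt x h1
  refine h2.congr_fderiv ?_
  ext v
  simp
  field_simp

theorem hasFDerivAt_inner_mul_norm_inv (p : E3) {x : E3} (hx : x ≠ 0) :
    HasFDerivAt (fun y : E3 => inner ℝ p y * ‖y‖⁻¹)
      (‖x‖⁻¹ • innerSL ℝ p - (inner ℝ p x * ‖x‖⁻¹ ^ 3) • innerSL ℝ x) x := by
  have h := (innerSL ℝ p).hasFDerivAt.mul (hasFDerivAt_norm_inv hx)
  refine h.congr_fderiv ?_
  ext v
  simp
  ring

theorem contDiffAt_radialExt_zonal {γ : ℝ → ℝ} (hγ : ∀ t ∈ Set.Icc (-1 : ℝ) 1, ContDiffAt ℝ 2 γ t)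
    (p : S2) {x : E3} (hx : x ≠ 0) : ContDiffAt ℝ 2 (radialExt (zonal γ p)) x := by
  have h1 : ContDiffAt ℝ 2 (fun y : E3 => inner ℝ (p : E3) y * ‖y‖⁻¹) x :=
    (contDiffAt_const.inner ℝ contDiffAt_id).mul
      ((contDiffAt_norm ℝ hx).inv (norm_ne_zero_iff.2 hx))
  refine ((hγ _ (inner_mul_norm_inv_mem_Icc p hx)).comp x h1).congr_of_eventuallyEq ?_
  filter_upwards [isOpen_ne.mem_nhds hx] with y hy
  exact radialExt_zonal γ p hy

theorem fderiv_radialExt_zonal {γ : ℝ → ℝ} (hγ : ∀ t ∈ Set.Icc (-1 : ℝ) 1, ContDiffAt ℝ 2 γ t)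
    (p : S2) {x : E3} (hx : x ≠ 0) (v : E3) :
    fderiv ℝ (radialExt (zonal γ p)) x v = deriv γ (inner ℝ (p : E3) x * ‖x‖⁻¹) *
      (inner ℝ (p : E3) v * ‖x‖⁻¹ - inner ℝ (p : E3) x * ‖x‖⁻¹ ^ 3 * inner ℝ x v) := by
  have h1 := ((hγ _ (inner_mul_norm_inv_mem_Icc p hx)).differentiableAt
    (by norm_num)).hasDerivAt.comp_hasFDerivAt x (hasFDerivAt_inner_mul_norm_inv (p : E3) hx)
  have h2 : radialExt (zonal γ p) =ᶠ[nhds x] γ ∘ fun y : E3 => inner ℝ (p : E3) y * ‖y‖⁻¹ := by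
    filter_upwards [isOpen_ne.mem_nhds hx] with y hy
    exact radialExt_zonal γ p hy
  rw [(h1.congr_of_eventuallyEq h2).fderiv]
  simp
  left
  ring

theorem fderiv_fderiv_radialExt_zonal {γ : ℝ → ℝ}
    (hγ : ∀ t ∈ Set.Icc (-1 : ℝ) 1, ContDiffAt ℝ 2 γ t) (p q : S2) (v : E3) :
    fderiv ℝ (fun y => fderiv ℝ (radialExt (zonal γ p)) y v) (q : E3) v =
      deriv (deriv γ) (inner ℝ (p : E3) (q : E3)) *
        (inner ℝ (p : E3) v - inner ℝ (p : E3) (q : E3) * inner ℝ (q : E3) v) ^ 2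
      + deriv γ (inner ℝ (p : E3) (q : E3)) *
        (3 * inner ℝ (p : E3) (q : E3) * inner ℝ (q : E3) v ^ 2
          - 2 * (inner ℝ (p : E3) v * inner ℝ (q : E3) v)
          - inner ℝ (p : E3) (q : E3) * inner ℝ v v) := by
  have hq : (q : E3) ≠ 0 := ne_zero_of_mem_unit_sphere q
  have hq1 : ‖(q : E3)‖ = 1 := norm_eq_of_mem_sphere q
  have h2 : (fun y => fderiv ℝ (radialExt (zonal γ p)) y v) =ᶠ[nhds (q : E3)] fun y =>
      deriv γ (inner ℝ (p : E3) y * ‖y‖⁻¹) *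
      (inner ℝ (p : E3) v * ‖y‖⁻¹ - inner ℝ (p : E3) y * ‖y‖⁻¹ ^ 3 * inner ℝ v y) := by
    filter_upwards [isOpen_ne.mem_nhds hq] with y hy
    rw [fderiv_radialExt_zonal hγ p hy, real_inner_comm v y]
  have hd : DifferentiableAt ℝ (deriv γ) (inner ℝ (p : E3) (q : E3) * ‖(q : E3)‖⁻¹) := by
    have h := (hγ _ (inner_mul_norm_inv_mem_Icc p hq)).fderiv_right (m := 1) (by norm_num)
    exact (h.clm_apply (contDiffAt_const (c := (1 : ℝ)))).differentiableAt (by norm_num)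
  have h3 := hd.hasDerivAt.comp_hasFDerivAt (q : E3) (hasFDerivAt_inner_mul_norm_inv (p : E3) hq)
  have h4 := ((hasFDerivAt_norm_inv hq).const_mul (inner ℝ (p : E3) v)).sub
    (((innerSL ℝ (p : E3)).hasFDerivAt.mul ((hasFDerivAt_norm_inv hq).pow 3)).mul
      (innerSL ℝ v).hasFDerivAt)
  have h5 : fderiv ℝ (fun y => fderiv ℝ (radialExt (zonal γ p)) y v) (q : E3) = _ :=
    ((h3.mul h4).congr_of_eventuallyEq h2).fderiv
  rw [h5]
  simp [hq1, real_inner_comm v]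
  ring

theorem sum_inner_single_mul (x y : E3) : ∑ i : Fin 3, inner ℝ x (EuclideanSpace.single i 1) *
    inner ℝ y (EuclideanSpace.single i 1) = inner ℝ x y := by
  have h := (EuclideanSpace.basisFun (Fin 3) ℝ).sum_inner_mul_inner x y
  simp only [EuclideanSpace.basisFun_apply] at h
  rw [← h]
  exact Finset.sum_congr rfl fun i _ => by rw [real_inner_comm _ y]

/-- Sum the second derivatives over the standard basis. By Parseval, the coefficient of γ'' is |p -
t q|² = 1 - t², and that of γ' is 3t - 2t - 3t = -2t. -/
theorem sphereLap_zonal {γ : ℝ → ℝ} (hγ : ∀ t ∈ Set.Icc (-1 : ℝ) 1, ContDiffAt ℝ 2 γ t)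
    (p q : S2) : sphereLap (zonal γ p) q = zonal (fun t => (1 - t ^ 2) * deriv (deriv γ) t
      - 2 * t * deriv γ t) p q := by
  have hq : (q : E3) ≠ 0 := ne_zero_of_mem_unit_sphere q
  rw [sphereLap, laplacian_eq_sum_fderiv (contDiffAt_radialExt_zonal hγ p hq)]
  simp only [fderiv_fderiv_radialExt_zonal hγ, zonal]
  generalize deriv (deriv γ) (inner ℝ (p : E3) (q : E3)) = a
  generalize deriv γ (inner ℝ (p : E3) (q : E3)) = b
  have h1 := sum_inner_single_mul (p : E3) p
  have h2 := sum_inner_single_mul (p : E3) q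
  have h3 := sum_inner_single_mul (q : E3) q
  rw [real_inner_self_eq_norm_sq, norm_eq_of_mem_sphere] at h1 h3
  generalize inner ℝ (p : E3) (q : E3) = t at *
  simp only [Fin.sum_univ_three, EuclideanSpace.inner_single_right] at *
  simp at *
  linear_combination a * h1 - 2 * a * t * h2 + a * t ^ 2 * h3 + b * (3 * t * h3 - 2 * h2)

/-- Green's second identity against the constant function 1. -/
theorem integral_sphereLap_zonal {γ : ℝ → ℝ}
    (hγ : ∀ t ∈ Set.Icc (-1 : ℝ) 1, ContDiffAt ℝ 2 γ t) (p : S2) :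
    ∫ q, zonal (fun t => (1 - t ^ 2) * deriv (deriv γ) t - 2 * t * deriv γ t) p q ∂sphereArea
      = 0 := by
  have h := integral_mul_sphereLap_sub (f := zonal γ p) (g := zonal (fun _ => 1) p)
    (fun x hx => contDiffAt_radialExt_zonal hγ p hx)
    (fun x hx => contDiffAt_radialExt_zonal (fun _ _ => contDiffAt_const) p hx)
  rw [← h]
  refine integral_congr_ae (Filter.Eventually.of_forall fun q => ?_)
  simp only [sphereLap_zonal hγ, sphereLap_zonal (γ := fun _ => (1 : ℝ))
    (fun _ _ => contDiffAt_const)]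
  simp [zonal]

/-! ### Archimedes' theorem by moments -/

theorem integrable_zonal {γ : ℝ → ℝ} (hγ : ContinuousOn γ (Set.Icc (-1) 1)) (p : S2) :
    Integrable (zonal γ p) sphereArea :=
  C2Sphere.integrable_of_continuous (continuous_zonal hγ p)

/-- The Legendre operator sends t^(k+1) to (k+1)(k t^(k-1) - (k+2) t^(k+1)), and the result
integrates to zero. This two-step recursion, started from the total area and the vanishing first
moment, determines all moments. -/
theorem integral_zonal_pow (p : S2) (n : ℕ) :
    ∫ q, zonal (fun t => t ^ n) p q ∂sphereArea = 2 * Real.pi * ∫ t in (-1 : ℝ)..1, t ^ n := by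
  -- For k = 0 the truncated exponent k - 1 is harmless, being multiplied by k.
  have hrec (k : ℕ) : ((k : ℝ) + 2) * ∫ q, zonal (fun t => t ^ (k + 1)) p q ∂sphereArea
      = k * ∫ q, zonal (fun t => t ^ (k - 1)) p q ∂sphereArea := by
    have h := integral_sphereLap_zonal (γ := fun t : ℝ => t ^ (k + 1))
      (fun t _ => (contDiff_id.pow _).contDiffAt) p
    have hd : deriv (fun t : ℝ => t ^ (k + 1)) = fun t => ((k : ℝ) + 1) * t ^ k := by
      ext t; simp
    have hd2 : deriv (fun t : ℝ => ((k : ℝ) + 1) * t ^ k)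
        = fun t => ((k : ℝ) + 1) * (k * t ^ (k - 1)) := by
      ext t; simp
    have hz : ∀ q, zonal (fun t : ℝ => (1 - t ^ 2) * deriv (deriv (fun t : ℝ => t ^ (k + 1))) t
        - 2 * t * deriv (fun t : ℝ => t ^ (k + 1)) t) p q
        = ((k : ℝ) + 1) * k * zonal (fun t => t ^ (k - 1)) p q
          - ((k : ℝ) + 1) * (k + 2) * zonal (fun t => t ^ (k + 1)) p q := by
      intro q
      rw [hd, hd2]
      simp only [zonal]
      rcases k with _ | k
      · simp
      · simp only [Nat.add_sub_cancel]; push_cast; ring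
    simp only [hz] at h
    rw [integral_sub ((integrable_zonal (by fun_prop) p).const_mul _)
      ((integrable_zonal (by fun_prop) p).const_mul _), integral_const_mul, integral_const_mul] at h
    have hk : (k : ℝ) + 1 ≠ 0 := by positivity
    refine mul_left_cancel₀ hk ?_
    linear_combination -h
  induction n using Nat.strong_induction_on with
  | _ n ih =>
    rcases n with _ | _ | n
    · have := sphereArea_univ
      simp [zonal, this]
      ring
    · have := hrec 0
      simp at this
      simp [this]
    · have h1 := hrec (n + 1)
      rw [Nat.add_sub_cancel, ih n (by omega)] at h1
      simp only [integral_pow] at h1 ⊢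
      have hn : (n : ℝ) + 1 ≠ 0 := by positivity
      have hn3 : (n : ℝ) + 3 ≠ 0 := by positivity
      push_cast at h1 ⊢
      refine mul_left_cancel₀ hn3 ?_
      have : (n : ℝ) + 1 + 2 = n + 3 := by ring
      rw [this] at h1
      rw [h1]
      have : (n : ℝ) + 1 + 1 + 1 = n + 3 := by ring
      rw [this]
      field_simp
      ring

theorem integral_zonal_polynomial (p : S2) (P : Polynomial ℝ) :
    ∫ q, zonal (fun t => P.eval t) p q ∂sphereArea
      = 2 * Real.pi * ∫ t in (-1 : ℝ)..1, P.eval t := by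
  simp only [zonal, Polynomial.eval_eq_sum, Polynomial.sum]
  rw [integral_finsetSum, intervalIntegral.integral_finsetSum, Finset.mul_sum]
  · refine Finset.sum_congr rfl fun n _ => ?_
    rw [integral_const_mul, intervalIntegral.integral_const_mul]
    have := integral_zonal_pow p n
    simp only [zonal] at this
    rw [this]
    ring
  · exact fun n _ => Continuous.intervalIntegrable (by fun_prop) _ _
  · exact fun n _ => (integrable_zonal (γ := fun t => t ^ n) (continuous_pow n).continuousOn
      p).const_mul _

/-- Archimedes' theorem: the height of a random point of the sphere is uniformly distributed. -/
theorem integral_zonal {γ : ℝ → ℝ} (hγ : ContinuousOn γ (Set.Icc (-1) 1)) (p : S2) :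
    ∫ q, zonal γ p q ∂sphereArea = 2 * Real.pi * ∫ t in (-1 : ℝ)..1, γ t := by
  refine eq_of_abs_sub_le_all fun ε hε => ?_
  -- With this Weierstrass tolerance each side costs ε/2: a factor 4π from the area of the sphere,
  -- and 2π · 2 from the interval.
  have hδ : 0 < ε / (8 * Real.pi) := by positivity
  obtain ⟨P, hP⟩ := exists_polynomial_near_of_continuousOn (-1) 1 γ hγ _ hδ
  have h1 : |∫ q, zonal γ p q ∂sphereArea - ∫ q, zonal (fun t => P.eval t) p q ∂sphereArea|
      ≤ ε / (8 * Real.pi) * (4 * Real.pi) := by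
    rw [← integral_sub (integrable_zonal hγ p) (integrable_zonal (by fun_prop) p),
      ← sphereArea_univ, ← Real.norm_eq_abs]
    refine norm_integral_le_of_norm_le_const (Filter.Eventually.of_forall fun q => ?_)
    rw [Real.norm_eq_abs, abs_sub_comm]
    exact (hP _ (inner_mem_Icc p q)).le
  have h2 : |(∫ t in (-1 : ℝ)..1, P.eval t) - ∫ t in (-1 : ℝ)..1, γ t|
      ≤ ε / (8 * Real.pi) * 2 := by
    rw [← intervalIntegral.integral_sub (Continuous.intervalIntegrable (by fun_prop) _ _)
      (ContinuousOn.intervalIntegrable (by rwa [Set.uIcc_of_le (by norm_num)])),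
      ← Real.norm_eq_abs]
    refine (intervalIntegral.norm_integral_le_of_norm_le_const (C := ε / (8 * Real.pi)) ?_).trans
      (by norm_num)
    intro t ht
    rw [Set.uIoc_of_le (by norm_num)] at ht
    exact (hP t ⟨ht.1.le, ht.2⟩).le
  rw [integral_zonal_polynomial] at h1
  have h3 : |2 * Real.pi * (∫ t in (-1 : ℝ)..1, P.eval t) - 2 * Real.pi * ∫ t in (-1 : ℝ)..1, γ t|
      ≤ 2 * Real.pi * (ε / (8 * Real.pi) * 2) := by
    rw [← mul_sub, abs_mul, abs_of_pos (by positivity)]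
    gcongr
  have h4 := (abs_sub_le _ _ _).trans (add_le_add h1 h3)
  refine h4.trans (le_of_eq ?_)
  field_simp
  ring

/-! ### The regularized Green function -/

/-- A regularization of (a multiple of) the mean-free Green function of the sphere, as a function of
the height. -/
def logKernel (ε t : ℝ) : ℝ := Real.log ((1 + ε - t) / 2) + 1

/-- An approximate identity on the sphere, as a function of the height. -/
def peakKernel (ε t : ℝ) : ℝ := ε * (2 + ε) / (1 + ε - t) ^ 2

theorem one_add_sub_pos {ε t : ℝ} (hε : 0 < ε) (ht : t ∈ Set.Icc (-1 : ℝ) 1) : 0 < 1 + ε - t := by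
  linarith [ht.2]

theorem contDiffAt_logKernel {ε : ℝ} (hε : 0 < ε) {t : ℝ} (ht : t ∈ Set.Icc (-1 : ℝ) 1) :
    ContDiffAt ℝ 2 (logKernel ε) t := by
  have h := one_add_sub_pos hε ht
  exact (((contDiffAt_const.sub contDiffAt_id).div_const 2).log (by simp; linarith)).add
    contDiffAt_const

theorem hasDerivAt_logKernel {ε t : ℝ} (h : 0 < 1 + ε - t) :
    HasDerivAt (logKernel ε) (-(1 + ε - t)⁻¹) t := by
  have h1 : HasDerivAt (fun t : ℝ => (1 + ε - t) / 2) (-1 / 2) t :=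
    ((hasDerivAt_id t).const_sub (1 + ε)).div_const 2
  refine ((h1.log (by positivity)).add_const 1).congr_deriv ?_
  field_simp

theorem deriv_deriv_logKernel {ε t : ℝ} (h : 0 < 1 + ε - t) :
    deriv (deriv (logKernel ε)) t = -((1 + ε - t) ^ 2)⁻¹ := by
  have h1 : deriv (logKernel ε) =ᶠ[nhds t] fun t => -(1 + ε - t)⁻¹ := by
    filter_upwards [gt_mem_nhds (show t < 1 + ε by linarith)] with s hs
    exact (hasDerivAt_logKernel (by linarith)).deriv
  rw [h1.deriv_eq]
  have h2 : HasDerivAt (fun t : ℝ => -(1 + ε - t)⁻¹) _ t :=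
    (((hasDerivAt_id t).const_sub (1 + ε)).inv h.ne').neg
  rw [h2.deriv]
  simp [div_eq_mul_inv]

/-- With s = 1 + ε - t, the numerator over s² is 2t(1 + ε) - 1 - t² = (1 + ε)² - 1 - s², and (1 +
ε)² - 1 = ε(2 + ε). -/
theorem legendre_logKernel {ε t : ℝ} (h : 0 < 1 + ε - t) :
    (1 - t ^ 2) * deriv (deriv (logKernel ε)) t - 2 * t * deriv (logKernel ε) t
      = peakKernel ε t - 1 := by
  rw [deriv_deriv_logKernel h, (hasDerivAt_logKernel h).deriv, peakKernel]
  field_simp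
  ring

theorem continuousOn_logKernel {ε : ℝ} (hε : 0 < ε) :
    ContinuousOn (logKernel ε) (Set.Icc (-1) 1) :=
  fun _ ht => (contDiffAt_logKernel hε ht).continuousAt.continuousWithinAt

theorem continuousOn_peakKernel {ε : ℝ} (hε : 0 < ε) :
    ContinuousOn (peakKernel ε) (Set.Icc (-1) 1) := by
  refine continuousOn_const.div (by fun_prop) fun t ht => ?_
  have := one_add_sub_pos hε ht
  positivity

theorem sphereLap_zonal_logKernel {ε : ℝ} (hε : 0 < ε) (p q : S2) :
    sphereLap (zonal (logKernel ε) p) q = zonal (peakKernel ε) p q - 1 := by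
  rw [sphereLap_zonal fun t ht => contDiffAt_logKernel hε ht]
  exact legendre_logKernel (one_add_sub_pos hε (inner_mem_Icc p q))

/-- The kernel minus 1 is a Laplacian, hence has integral zero; its mass is the area of the sphere.
-/
theorem integral_peakKernel {ε : ℝ} (hε : 0 < ε) (p : S2) :
    ∫ q, zonal (peakKernel ε) p q ∂sphereArea = 4 * Real.pi := by
  have h := integral_sphereLap_zonal (fun t ht => contDiffAt_logKernel hε ht) p
  have h1 : ∀ q, zonal (fun t => (1 - t ^ 2) * deriv (deriv (logKernel ε)) t
      - 2 * t * deriv (logKernel ε) t) p q = zonal (peakKernel ε) p q - 1 := fun q =>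
    legendre_logKernel (one_add_sub_pos hε (inner_mem_Icc p q))
  simp only [h1] at h
  rw [integral_sub (integrable_zonal (continuousOn_peakKernel hε) p) (integrable_const _)] at h
  have := sphereArea_univ
  simp [this] at h
  linarith

/-- In the variable s = (1 + ε - t)/2 the integrand (log s + 1)² has the antiderivative s (log² s +
1). The endpoint t = 1 contributes with a favourable sign and is dropped; the resulting bound tends
to 4π with ε. -/
theorem integral_logKernel_sq_le {ε : ℝ} (hε : 0 < ε) (p : S2) :
    ∫ q, zonal (logKernel ε) p q ^ 2 ∂sphereArea
      ≤ 2 * Real.pi * ((2 + ε) * ((ε / 2) ^ 2 + 1)) := by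
  have hc : ContinuousOn (fun t => logKernel ε t ^ 2) (Set.Icc (-1) 1) :=
    (continuousOn_logKernel hε).pow 2
  have h := integral_zonal hc p
  have h1 : ∫ q, zonal (logKernel ε) p q ^ 2 ∂sphereArea
      = ∫ q, zonal (fun t => logKernel ε t ^ 2) p q ∂sphereArea := rfl
  rw [h1, h]
  have h2 : ∫ t in (-1 : ℝ)..1, logKernel ε t ^ 2 = _ :=
    intervalIntegral.integral_eq_sub_of_hasDerivAt
      (f := fun t => -((1 + ε - t) * (Real.log ((1 + ε - t) / 2) ^ 2 + 1))) (fun t ht => by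
        rw [Set.uIcc_of_le (by norm_num)] at ht
        have hp := one_add_sub_pos hε ht
        have h3 : HasDerivAt (fun t : ℝ => 1 + ε - t) (-1) t :=
          (hasDerivAt_id t).const_sub (1 + ε)
        have h4 := (h3.div_const 2).log (by positivity)
        refine ((h3.mul ((h4.pow 2).add_const 1)).neg).congr_deriv ?_
        simp [logKernel]
        field_simp
        ring)
      (ContinuousOn.intervalIntegrable (by rwa [Set.uIcc_of_le (by norm_num)]))
  rw [h2]
  gcongr
  have e1 : 1 + ε - 1 = ε := by ring
  have e2 : 1 + ε - -1 = 2 + ε := by ring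
  have h5 : Real.log ((2 + ε) / 2) ≤ ε / 2 := by
    have := Real.log_le_sub_one_of_pos (show 0 < (2 + ε) / 2 by positivity)
    linarith
  have h6 : 0 ≤ Real.log ((2 + ε) / 2) := Real.log_nonneg (by linarith)
  have h7 : 0 ≤ ε * (Real.log (ε / 2) ^ 2 + 1) := by positivity
  have h8 : (2 + ε) * (Real.log ((2 + ε) / 2) ^ 2 + 1) ≤ (2 + ε) * ((ε / 2) ^ 2 + 1) := by
    gcongr
  simp only [e1, e2]
  linarith

/-! ### Concentration of the peak kernel -/

theorem norm_sub_sq_sphere (p q : S2) :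
    ‖(q : E3) - p‖ ^ 2 = 2 * (1 - inner ℝ (p : E3) (q : E3)) := by
  rw [norm_sub_sq_real, norm_eq_of_mem_sphere, norm_eq_of_mem_sphere, real_inner_comm]
  ring

/-- Near p this is continuity; at distance at least r from p, f is bounded and 1 - t ≥ r²/2. The
square is chosen to absorb the denominator of `peakKernel`, so that the second term contributes
O(ε). -/
theorem exists_abs_sub_le {f : S2 → ℝ} (hf : Continuous f) (p : S2) {δ : ℝ} (hδ : 0 < δ) :
    ∃ C, ∀ q, |f q - f p| ≤ δ + C * (1 - inner ℝ (p : E3) (q : E3)) ^ 2 := by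
  obtain ⟨r, hr, h⟩ := Metric.continuousAt_iff.1 hf.continuousAt δ hδ
  obtain ⟨M, hM⟩ := isCompact_univ.exists_bound_of_continuousOn
    (hf.sub (continuous_const (y := f p))).continuousOn
  refine ⟨|M| / (r ^ 2 / 2) ^ 2, fun q => ?_⟩
  by_cases hq : dist q p < r
  · have := (h hq).le
    rw [Real.dist_eq] at this
    have h2 : 0 ≤ |M| / (r ^ 2 / 2) ^ 2 * (1 - inner ℝ (p : E3) (q : E3)) ^ 2 := by positivity
    linarith
  · have h1 : |f q - f p| ≤ |M| := (hM q (Set.mem_univ q)).trans (le_abs_self M)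
    rw [not_lt, Subtype.dist_eq, dist_eq_norm] at hq
    have h2 : r ^ 2 / 2 ≤ 1 - inner ℝ (p : E3) (q : E3) := by
      have := norm_sub_sq_sphere p q
      have := pow_le_pow_left₀ hr.le hq 2
      linarith
    have h3 : (r ^ 2 / 2) ^ 2 ≤ (1 - inner ℝ (p : E3) (q : E3)) ^ 2 :=
      pow_le_pow_left₀ (by positivity) h2 2
    have h4 : |M| ≤ |M| / (r ^ 2 / 2) ^ 2 * (1 - inner ℝ (p : E3) (q : E3)) ^ 2 := by
      rw [div_mul_eq_mul_div, le_div_iff₀ (by positivity)]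
      gcongr
    linarith

theorem peakKernel_mul_sq_le {ε t : ℝ} (hε : 0 < ε) (ht : t ∈ Set.Icc (-1 : ℝ) 1) :
    peakKernel ε t * (1 - t) ^ 2 ≤ ε * (2 + ε) := by
  have hp := one_add_sub_pos hε ht
  rw [peakKernel, div_mul_eq_mul_div, div_le_iff₀ (by positivity)]
  have : (1 - t) ^ 2 ≤ (1 + ε - t) ^ 2 := pow_le_pow_left₀ (by linarith [ht.2]) (by linarith) 2
  gcongr

theorem tendsto_integral_peakKernel_mul {f : S2 → ℝ} (hf : Continuous f) (p : S2) :
    Filter.Tendsto (fun ε => ∫ q, zonal (peakKernel ε) p q * f q ∂sphereArea)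
      (nhdsWithin 0 (Set.Ioi 0)) (nhds (4 * Real.pi * f p)) := by
  rw [Metric.tendsto_nhds]
  intro δ hδ
  have hpi := Real.pi_pos
  -- Integrated against a kernel of mass 4π, this tolerance gives δ/2.
  obtain ⟨C, hC⟩ := exists_abs_sub_le hf p (show 0 < δ / (8 * Real.pi) by positivity)
  have hlim : Filter.Tendsto (fun ε : ℝ => δ / 2 + |C| * (ε * (2 + ε)) * (4 * Real.pi))
      (nhdsWithin 0 (Set.Ioi 0)) (nhds (δ / 2 + |C| * (0 * (2 + 0)) * (4 * Real.pi))) :=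
    (Continuous.tendsto (by fun_prop) 0).mono_left nhdsWithin_le_nhds
  have hlt : δ / 2 + |C| * (0 * (2 + 0)) * (4 * Real.pi) < δ := by simp [hδ]
  filter_upwards [hlim.eventually_lt_const hlt, self_mem_nhdsWithin] with ε hε1 hε
  rw [Set.mem_Ioi] at hε
  refine lt_of_le_of_lt ?_ hε1
  have hk := continuous_zonal (continuousOn_peakKernel hε) p
  have h1 : (∫ q, zonal (peakKernel ε) p q * f q ∂sphereArea) - 4 * Real.pi * f p
      = ∫ q, zonal (peakKernel ε) p q * (f q - f p) ∂sphereArea := by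
    have i1 : Integrable (fun q => zonal (peakKernel ε) p q * f q) sphereArea :=
      C2Sphere.integrable_of_continuous (hk.mul hf)
    have i2 : Integrable (fun q => zonal (peakKernel ε) p q * f p) sphereArea :=
      C2Sphere.integrable_of_continuous (hk.mul continuous_const)
    simp only [mul_sub]
    rw [integral_sub i1 i2, integral_mul_const, integral_peakKernel hε]
  rw [Real.dist_eq, h1, ← Real.norm_eq_abs]
  refine (norm_integral_le_of_norm_le (g := fun q => zonal (peakKernel ε) p q *
    (δ / (8 * Real.pi)) + |C| * (ε * (2 + ε))) ?_ (Filter.Eventually.of_forall fun q => ?_)).trans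
    (le_of_eq ?_)
  · exact C2Sphere.integrable_of_continuous ((hk.mul continuous_const).add continuous_const)
  · have ht := inner_mem_Icc p q
    have hp := one_add_sub_pos hε ht
    have hpos : 0 ≤ zonal (peakKernel ε) p q := by
      rw [zonal, peakKernel]; positivity
    rw [norm_mul, Real.norm_of_nonneg hpos, Real.norm_eq_abs]
    calc zonal (peakKernel ε) p q * |f q - f p|
        ≤ zonal (peakKernel ε) p q * (δ / (8 * Real.pi)
          + |C| * (1 - inner ℝ (p : E3) (q : E3)) ^ 2) := by
          gcongr
          exact (hC q).trans (by gcongr; exact le_abs_self C)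
      _ = zonal (peakKernel ε) p q * (δ / (8 * Real.pi))
          + |C| * (zonal (peakKernel ε) p q * (1 - inner ℝ (p : E3) (q : E3)) ^ 2) := by ring
      _ ≤ _ := by
          exact add_le_add_right (mul_le_mul_of_nonneg_left (peakKernel_mul_sq_le hε ht)
            (abs_nonneg C)) _
  · have i1 : Integrable (fun q => zonal (peakKernel ε) p q * (δ / (8 * Real.pi))) sphereArea :=
      C2Sphere.integrable_of_continuous (hk.mul continuous_const)
    rw [integral_add i1 (integrable_const _), integral_mul_const, integral_peakKernel hε, integral_const,
      sphereArea_univ, smul_eq_mul]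
    field_simp
    ring

/-! ### The pointwise bound for smooth functions -/

theorem sq_integral_mul_le {a b : S2 → ℝ} (ha : Continuous a) (hb : Continuous b) :
    (∫ q, a q * b q ∂sphereArea) ^ 2
      ≤ (∫ q, a q ^ 2 ∂sphereArea) * ∫ q, b q ^ 2 ∂sphereArea := by
  have h := real_inner_mul_inner_self_le
    (ContinuousMap.toLp 2 sphereArea ℝ (⟨a, ha⟩ : C(S2, ℝ)))
    (ContinuousMap.toLp 2 sphereArea ℝ (⟨b, hb⟩ : C(S2, ℝ)))
  simp only [ContinuousMap.inner_toLp, ContinuousMap.coe_mk, conj_trivial] at h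
  simp only [pow_two]
  simpa only [mul_comm] using h

/-- The regularized representation formula: Green's second identity for f and the logarithmic
kernel. The factor 1 is kept to fit Cauchy–Schwarz. -/
theorem integral_peakKernel_mul {f : S2 → ℝ} (hf : ContMDiff (𝓡 2) 𝓘(ℝ, ℝ) 2 f) {ε : ℝ}
    (hε : 0 < ε) (p : S2) :
    ∫ q, zonal (peakKernel ε) p q * f q ∂sphereArea
      = (∫ q, 1 * f q ∂sphereArea)
        + ∫ q, zonal (logKernel ε) p q * sphereLap f q ∂sphereArea := by
  have h := integral_mul_sphereLap_sub (f := f) (g := zonal (logKernel ε) p)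
    (fun x hx => contDiffAt_radialExt hf hx)
    (fun x hx => contDiffAt_radialExt_zonal (fun t ht => contDiffAt_logKernel hε ht) p hx)
  have hk := continuous_zonal (continuousOn_peakKernel hε) p
  have hl := continuous_zonal (continuousOn_logKernel hε) p
  have hfc := hf.continuous
  have h1 : ∀ q, zonal (logKernel ε) p q * sphereLap f q
      - f q * sphereLap (zonal (logKernel ε) p) q
      = zonal (logKernel ε) p q * sphereLap f q + 1 * f q - zonal (peakKernel ε) p q * f q := by
    intro q
    rw [sphereLap_zonal_logKernel hε]
    ring
  have i1 : Integrable (fun q => zonal (logKernel ε) p q * sphereLap f q) sphereArea :=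
    C2Sphere.integrable_of_continuous (hl.mul (continuous_sphereLap hf))
  have i2 : Integrable (fun q => 1 * f q) sphereArea :=
    C2Sphere.integrable_of_continuous (continuous_const.mul hfc)
  have i3 : Integrable (fun q => zonal (peakKernel ε) p q * f q) sphereArea :=
    C2Sphere.integrable_of_continuous (hk.mul hfc)
  have i4 : Integrable (fun q => zonal (logKernel ε) p q * sphereLap f q + 1 * f q) sphereArea :=
    i1.add i2
  simp only [h1] at h
  rw [integral_sub i4 i3, integral_add i1 i2] at h
  linarith

/-- The pointwise Sobolev bound for functions of class `C^2`. -/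
theorem C2Sphere.toFun_sq_le (f : C2Sphere) (p : S2) :
    f.toFun p ^ 2 ≤ ‖f‖ ^ 2 / (2 * Real.pi) := by
  have hpi := Real.pi_pos
  set A := ∫ q, f.toFun q ^ 2 ∂sphereArea with hA
  set B := ∫ q, sphereLap f.toFun q ^ 2 ∂sphereArea with hB
  have hA0 : 0 ≤ A := integral_nonneg fun q => sq_nonneg _
  have hB0 : 0 ≤ B := integral_nonneg fun q => sq_nonneg _
  have hAB : A + B ≤ ‖f‖ ^ 2 := by
    have h2 : 0 ≤ ∫ p, ‖sphereGrad f.toFun p‖ ^ 2 ∂sphereArea :=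
      integral_nonneg fun p => sq_nonneg _
    rw [C2Sphere.norm_eq, Real.sq_sqrt (by positivity)]
    linarith
  have h1 : ∀ ε > 0, (∫ q, zonal (peakKernel ε) p q * f.toFun q ∂sphereArea) ^ 2
      ≤ (4 * Real.pi + 2 * Real.pi * ((2 + ε) * ((ε / 2) ^ 2 + 1))) * (A + B) := by
    intro ε hε
    rw [integral_peakKernel_mul f.contMDiff hε]
    have c1 := sq_integral_mul_le (continuous_const (y := (1 : ℝ))) f.continuous_toFun
    have c2 := sq_integral_mul_le (continuous_zonal (continuousOn_logKernel hε) p)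
      (continuous_sphereLap f.contMDiff)
    have c3 := integral_logKernel_sq_le hε p
    have c4 : ∫ _q : S2, (1 : ℝ) ^ 2 ∂sphereArea = 4 * Real.pi := by
      simp [sphereArea_univ]
    rw [c4, ← hA] at c1
    rw [← hB] at c2
    have c5 := c2.trans (mul_le_mul_of_nonneg_right c3 hB0)
    set X := ∫ q, 1 * f.toFun q ∂sphereArea
    set Y := ∫ q, zonal (logKernel ε) p q * sphereLap f.toFun q ∂sphereArea
    set L := 2 * Real.pi * ((2 + ε) * ((ε / 2) ^ 2 + 1))
    have hL : 0 < L := by positivity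
    -- From X² ≤ 4πA and Y² ≤ LB, these weights give 2XY ≤ LA + 4πB, hence (X + Y)² ≤ (4π + L)(A +
    -- B).
    have c6 : 2 * (X * Y) ≤ L / (4 * Real.pi) * X ^ 2 + 4 * Real.pi / L * Y ^ 2 := by
      have h4 : L / (4 * Real.pi) * X ^ 2 + 4 * Real.pi / L * Y ^ 2 - 2 * (X * Y)
          = (L * X - 4 * Real.pi * Y) ^ 2 / (4 * Real.pi * L) := by
        field_simp
        ring
      have h5 : 0 ≤ (L * X - 4 * Real.pi * Y) ^ 2 / (4 * Real.pi * L) := by positivity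
      linarith
    have c7 : L / (4 * Real.pi) * X ^ 2 ≤ L * A := by
      calc L / (4 * Real.pi) * X ^ 2 ≤ L / (4 * Real.pi) * (4 * Real.pi * A) := by gcongr
        _ = L * A := by field_simp
    have c8 : 4 * Real.pi / L * Y ^ 2 ≤ 4 * Real.pi * B := by
      calc 4 * Real.pi / L * Y ^ 2 ≤ 4 * Real.pi / L * (L * B) := by gcongr
        _ = 4 * Real.pi * B := by field_simp
    nlinarith
  have hl : Filter.Tendsto (fun ε : ℝ =>
      (4 * Real.pi + 2 * Real.pi * ((2 + ε) * ((ε / 2) ^ 2 + 1))) * (A + B))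
      (nhdsWithin 0 (Set.Ioi 0))
      (nhds ((4 * Real.pi + 2 * Real.pi * ((2 + 0) * ((0 / 2) ^ 2 + 1))) * (A + B))) :=
    (Continuous.tendsto (by fun_prop) 0).mono_left nhdsWithin_le_nhds
  have h2 := le_of_tendsto_of_tendsto
    ((tendsto_integral_peakKernel_mul f.continuous_toFun p).pow 2) hl
    (by filter_upwards [self_mem_nhdsWithin] with ε hε using h1 ε hε)
  rw [le_div_iff₀ (by positivity)]
  -- At ε = 0 the constant 4π + L is 8π, while (4π)² = 8π · 2π.
  have h3 : (8 * Real.pi) * (f.toFun p ^ 2 * (2 * Real.pi)) ≤ (8 * Real.pi) * (A + B) := by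
    refine le_of_eq_of_le ?_ (h2.trans (le_of_eq ?_)) <;> ring
  exact (le_of_mul_le_mul_left h3 (by positivity)).trans hAB

/-! ### Passage to the completion -/

theorem C2Sphere.norm_toContinuousMap_le (f : C2Sphere) :
    ‖f.toContinuousMap‖ ≤ √2 / √(4 * Real.pi) * ‖f‖ := by
  have hpi := Real.pi_pos
  rw [ContinuousMap.norm_le _ (by positivity)]
  intro p
  refine abs_le_of_sq_le_sq ?_ (by positivity)
  refine (f.toFun_sq_le p).trans (le_of_eq ?_)
  rw [mul_pow, div_pow, Real.sq_sqrt (by positivity), Real.sq_sqrt (by positivity)]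
  field_simp
  norm_num

/-- The inclusion of `C^2(S^2)`, with the `H^2` norm, into the continuous functions. -/
def C2Sphere.toC0 : C2Sphere →L[ℝ] C(S2, ℝ) :=
  LinearMap.mkContinuous
    { toFun := fun f => f.toContinuousMap
      map_add' := fun _ _ => rfl
      map_smul' := fun _ _ => rfl }
    (√2 / √(4 * Real.pi)) fun f => f.norm_toContinuousMap_le

/-- The Sobolev embedding of `H^2(S^2)` into the continuous functions. -/
def H2Sphere.toC0 : H2Sphere →L[ℝ] C(S2, ℝ) :=
  C2Sphere.toC0.extend UniformSpace.Completion.toComplL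

theorem H2Sphere.toC0_coe (f : C2Sphere) : H2Sphere.toC0 (f : H2Sphere) = f.toContinuousMap :=
  ContinuousLinearMap.extend_eq _ UniformSpace.Completion.denseRange_coe
    (UniformSpace.Completion.isUniformInducing_coe _) f

theorem H2Sphere.norm_toC0_le (u : H2Sphere) :
    ‖H2Sphere.toC0 u‖ ≤ √2 / √(4 * Real.pi) * ‖u‖ := by
  induction u using UniformSpace.Completion.induction_on with
  | hp => exact isClosed_le (by fun_prop) (by fun_prop)
  | ih f =>
    rw [H2Sphere.toC0_coe, UniformSpace.Completion.norm_coe]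
    exact f.norm_toContinuousMap_le

/-- Both sides are continuous in u and agree on the dense subspace of C² functions. Hence the
extended embedding does give a continuous representative of the L² class. -/
theorem H2Sphere.toLp_toC0 (u : H2Sphere) :
    ContinuousMap.toLp 2 sphereArea ℝ (H2Sphere.toC0 u) = H2Sphere.toL2 u := by
  induction u using UniformSpace.Completion.induction_on with
  | hp => exact isClosed_eq (by fun_prop) (by fun_prop)
  | ih f =>
    rw [H2Sphere.toC0_coe, H2Sphere.toL2_coe]
    rfl

/-! ### Bounds for the series and conclusion -/

/-- The terms of the series bounding the embedding constant. -/
def sobolevTerm (l : ℕ) : ℝ :=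
  (2 * (l : ℝ) + 1) ^ 2 / (1 + (l : ℝ) * (l + 1) + (l : ℝ) ^ 2 * ((l : ℝ) + 1) ^ 2)

theorem sobolevTerm_nonneg (l : ℕ) : 0 ≤ sobolevTerm l := by
  unfold sobolevTerm; positivity

/-- With λ = (l + 1)(l + 2), the term is (4λ + 1)/(1 + λ + λ²), which is at most 4/λ. -/
theorem sobolevTerm_succ_le (l : ℕ) :
    sobolevTerm (l + 1) ≤ 4 * (1 / ((l : ℝ) + 1) - 1 / ((l + 1 : ℕ) + 1)) := by
  have h : 4 * (1 / ((l : ℝ) + 1) - 1 / ((l + 1 : ℕ) + 1)) = 4 / (((l : ℝ) + 1) * (l + 2)) := by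
    push_cast
    field_simp
    ring
  rw [h, sobolevTerm, div_le_div_iff₀ (by positivity) (by positivity)]
  push_cast
  have : (0 : ℝ) ≤ l := l.cast_nonneg
  nlinarith [mul_nonneg this this]

theorem hasSum_telescoping :
    HasSum (fun l : ℕ => 4 * (1 / ((l : ℝ) + 1) - 1 / ((l + 1 : ℕ) + 1))) 4 := by
  have h : HasSum (fun l : ℕ => 1 / ((l : ℝ) + 1) - 1 / ((l + 1 : ℕ) + 1)) 1 := by
    rw [hasSum_iff_tendsto_nat_of_nonneg]
    · simp only [Finset.sum_range_sub' (fun l : ℕ => 1 / ((l : ℝ) + 1))]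
      simpa using (tendsto_one_div_add_atTop_nhds_zero_nat (𝕜 := ℝ)).const_sub 1
    · intro l
      rw [sub_nonneg]
      push_cast
      gcongr
      linarith
  simpa using h.mul_left 4

theorem summable_sobolevTerm : Summable sobolevTerm := by
  rw [← summable_nat_add_iff 1]
  exact hasSum_telescoping.summable.of_nonneg_of_le (fun l => sobolevTerm_nonneg _)
    sobolevTerm_succ_le

theorem tsum_sobolevTerm_le : ∑' l, sobolevTerm l ≤ 5 := by
  rw [summable_sobolevTerm.tsum_eq_zero_add]
  have h := ((summable_nat_add_iff 1).2 summable_sobolevTerm).tsum_le_tsum sobolevTerm_succ_le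
    hasSum_telescoping.summable
  rw [hasSum_telescoping.tsum_eq] at h
  have h0 : sobolevTerm 0 = 1 := by simp [sobolevTerm]
  linarith

/-- The first two terms are 1 and 9/7. This lets √2 be replaced by the square root of the series. -/
theorem two_le_tsum_sobolevTerm : 2 ≤ ∑' l, sobolevTerm l := by
  refine le_trans ?_
    (summable_sobolevTerm.sum_le_tsum (Finset.range 2) fun l _ => sobolevTerm_nonneg l)
  norm_num [Finset.sum_range_succ, sobolevTerm]

end

theorem mainTheorem10 (u : H2Sphere) :
    Summable (fun l : ℕ =>
      (2 * (l : ℝ) + 1) ^ 2 / (1 + (l : ℝ) * (l + 1) + (l : ℝ) ^ 2 * ((l : ℝ) + 1) ^ 2)) ∧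
    (∃ g : C(S2, ℝ), (H2Sphere.toL2 u : S2 → ℝ) =ᵐ[sphereArea] g ∧
      ‖g‖ ≤ ‖u‖ / Real.sqrt (4 * Real.pi) *
        Real.sqrt (∑' l : ℕ,
          (2 * (l : ℝ) + 1) ^ 2 / (1 + (l : ℝ) * (l + 1) + (l : ℝ) ^ 2 * ((l : ℝ) + 1) ^ 2))) ∧
    (u ≠ 0 →
      ‖u‖ / Real.sqrt (4 * Real.pi) *
        Real.sqrt (∑' l : ℕ,
          (2 * (l : ℝ) + 1) ^ 2 / (1 + (l : ℝ) * (l + 1) + (l : ℝ) ^ 2 * ((l : ℝ) + 1) ^ 2))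
        < 1 / 2 * Real.sqrt (1 / Real.pi * (Real.pi ^ 2 / 3 + 2)) * ‖u‖) := by
  change Summable sobolevTerm ∧ (∃ g : C(S2, ℝ), (H2Sphere.toL2 u : S2 → ℝ) =ᵐ[sphereArea] g ∧
      ‖g‖ ≤ ‖u‖ / √(4 * Real.pi) * √(∑' l, sobolevTerm l)) ∧
    (u ≠ 0 → ‖u‖ / √(4 * Real.pi) * √(∑' l, sobolevTerm l)
      < 1 / 2 * √(1 / Real.pi * (Real.pi ^ 2 / 3 + 2)) * ‖u‖)
  have hpi := Real.pi_pos
  refine ⟨summable_sobolevTerm, ⟨H2Sphere.toC0 u, ?_, ?_⟩, fun hu => ?_⟩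
  · rw [← H2Sphere.toLp_toC0]
    exact ContinuousMap.coeFn_toLp sphereArea _
  · calc ‖H2Sphere.toC0 u‖ ≤ √2 / √(4 * Real.pi) * ‖u‖ := H2Sphere.norm_toC0_le u
      _ = ‖u‖ / √(4 * Real.pi) * √2 := by ring
      _ ≤ _ := by
        gcongr
        exact two_le_tsum_sobolevTerm
  · have hu' : 0 < ‖u‖ := norm_pos_iff.2 hu
    -- Strictness comes from π > 3, which gives π²/3 + 2 > 5.
    have h1 : √(∑' l, sobolevTerm l) < √(Real.pi ^ 2 / 3 + 2) := by
      refine Real.sqrt_lt_sqrt (by linarith [two_le_tsum_sobolevTerm]) ?_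
      have := Real.pi_gt_three
      nlinarith [tsum_sobolevTerm_le]
    have h2 : √(4 * Real.pi) = 2 * √Real.pi := by
      rw [Real.sqrt_mul (by norm_num), show (4 : ℝ) = 2 ^ 2 by norm_num,
        Real.sqrt_sq (by norm_num)]
    rw [h2, Real.sqrt_mul (by positivity), one_div Real.pi, Real.sqrt_inv]
    calc ‖u‖ / (2 * √Real.pi) * √(∑' l, sobolevTerm l)
        < ‖u‖ / (2 * √Real.pi) * √(Real.pi ^ 2 / 3 + 2) := by gcongr
      _ = _ := by field_simp
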